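/- **Theorem (Distributional tangential traces).** Let $\Omega\subset\mathbb R^3$ be open, let $1\le p\le\infty$, and let $F\in\mathscr{CM}^p(\Omega)$; that is, $F\in L^p(\Omega;\mathbb R^3)$ and the distributional curl of $F$ in $\Omega$ is represented by a finite $\mathbb R^3$-valued Radon measure on $\Omega$, again denoted $\operatorname{curl}F$. Equivalently, $\int_\Omega\varphi\,d(\operatorname{curl}F)=\int_\Omega F\times\nabla\varphi\,dx$ for all $\varphi\in C_c^\infty(\Omega)$. Let $U\Subset\Omega$ be open, i.e. $\overline U$ is compact and contained in $\Omega$. For $\varphi\in C_c^\infty(\Omega)$ put $$\langle (F\times\nu)^{\mathrm{int}}_U,\varphi\rangle_{\partial U}:=\int_U\varphi\,d(\operatorname{curl}F)-\int_U F\times\nabla\varphi\,dx,$$ $$\langle (F\times\nu)^{\mathrm{ext}}_U,\varphi\rangle_{\partial U}:=-\int_{\Omega\setminus\overline U}\varphi\,d(\operatorname{curl}F)+\int_{\Omega\setminus\overline U} F\times\nabla\varphi\,dx,$$ and, for $\bm\varphi=(\varphi_1,\varphi_2,\varphi_3)\in C_c^\infty(\Omega;\mathbb R^3)$ and $\bullet\in\{\mathrm{int},\mathrm{ext}\}$,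 put $$\langle (F\times\nu)^{\bullet}_U,\bm\varphi\rangle_{\partial U}:=\sum_{i=1}^3\langle (F\times\nu)^{\bullet}_{U,i},\varphi_i\rangle_{\partial U},$$ where $(F\times\nu)^{\bullet}_{U,i}$ denotes the $i$-th component of the functional $(F\times\nu)^{\bullet}_U$. Then, for $\bullet\in\{\mathrm{int},\mathrm{ext}\}$, the following hold. 1. $C_c^\infty(\Omega)\ni\varphi\mapsto\langle (F\times\nu)^{\bullet}_U,\varphi\rangle_{\partial U}$ is an $\mathbb R^3$-valued distribution on $\Omega$ of order at most one, supported on $\partial U$. 2. $C_c^\infty(\Omega;\mathbb R^3)\ni\bm\varphi\mapsto\langle (F\times\nu)^{\bullet}_U,\bm\varphi\rangle_{\partial U}$ is a (real-valued) distribution on $\Omega$ of order at most one, supported on $\partial U$. Moreover, $$\langle (F\times\nu)^{\mathrm{int}}_U,\bm\varphi\rangle_{\partial U}=\int_U\bm\varphi\cdot d(\operatorname{curl}F)-\int_U F\cdot\operatorname{curl}\bm\varphi\,dx,$$ $$\langle (F\times\nu)^{\mathrm{ext}}_U,\bm\varphi\rangle_{\partial U}=-\int_{\Omega\setminus\overline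 U}\bm\varphi\cdot d(\operatorname{curl}F)+\int_{\Omega\setminus\overline U} F\cdot\operatorname{curl}\bm\varphi\,dx.$$ Here a functional on test functions has order at most one if, for every compact $K\subset\Omega$, it is bounded by $C_K\|\cdot\|_{C^1}$ on the test functions supported in $K$. -/

import Mathlib

open MeasureTheory TopologicalSpace
open scoped ENNReal Distributions

noncomputable section

namespace TangentialTrace

/-- Three-dimensional Euclidean space. -/
abbrev E3 : Type := EuclideanSpace ℝ (Fin 3)

/-- The cross product `a × b` of two vectors of `ℝ³`. -/
def cross (a b : E3) : E3 :=
  !₂[a 1 * b 2 - a 2 * b 1, a 2 * b 0 - a 0 * b 2, a 0 * b 1 - a 1 * b 0]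

/-- The partial derivative `∂ⱼ Φᵢ (x)` of the `i`-th component of a vector field. -/
def partialDeriv (Φ : E3 → E3) (j i : Fin 3) (x : E3) : ℝ :=
  fderiv ℝ (fun y => Φ y i) x (EuclideanSpace.single j 1)

/-- The pointwise curl of a differentiable vector field. -/
def curl (Φ : E3 → E3) (x : E3) : E3 :=
  !₂[partialDeriv Φ 1 2 x - partialDeriv Φ 2 1 x,
     partialDeriv Φ 2 0 x - partialDeriv Φ 0 2 x,
     partialDeriv Φ 0 1 x - partialDeriv Φ 1 0 x]

/-- `μ` is a finite `ℝ³`-valued Radon measure on the open set `Ω` (extended by zero outside `Ω`)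
that represents the distributional curl of `F` in `Ω`. The last field is the componentwise form of
`⟨curl F, φ⟩ = ∫_Ω F × ∇φ dx`; for instance its first component reads
`⟨∂₂F₃ - ∂₃F₂, φ⟩ = ∫_Ω (F₂ ∂₃φ - F₃ ∂₂φ) dx`. -/
structure IsCurlMeasure (Ω : Opens E3) (F : E3 → E3) (μ : VectorMeasure E3 E3) : Prop where
  finite_variation : μ.variation Set.univ < ∞
  restrict_eq : μ.restrict (Ω : Set E3) = μ
  integral_eq : ∀ φ : 𝓓(Ω, ℝ),
    ∫ᵛ x in (Ω : Set E3), φ x ∂•μ = ∫ x in (Ω : Set E3), cross (F x) (gradient φ x)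

/-- `F ∈ CMᵖ(Ω)`: `F` belongs to `Lᵖ(Ω; ℝ³)` and its distributional curl is a finite
`ℝ³`-valued Radon measure on `Ω`. -/
def IsCurlMeasureField (p : ℝ≥0∞) (Ω : Opens E3) (F : E3 → E3) : Prop :=
  MemLp F p (volume.restrict (Ω : Set E3)) ∧ ∃ μ : VectorMeasure E3 E3, IsCurlMeasure Ω F μ

/-- Interior tangential trace of `F` (with `curl F = μ`) on `∂U`, tested with a scalar function. -/
def interiorTrace (F : E3 → E3) (μ : VectorMeasure E3 E3) (U : Set E3) (φ : E3 → ℝ) : E3 :=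
  (∫ᵛ x in U, φ x ∂•μ) - ∫ x in U, cross (F x) (gradient φ x)

/-- Exterior tangential trace of `F` (with `curl F = μ`) on `∂U`, tested with a scalar function. -/
def exteriorTrace (Ω : Opens E3) (F : E3 → E3) (μ : VectorMeasure E3 E3) (U : Set E3)
    (φ : E3 → ℝ) : E3 :=
  -(∫ᵛ x in ((Ω : Set E3) \ closure U), φ x ∂•μ)
    + ∫ x in (Ω : Set E3) \ closure U, cross (F x) (gradient φ x)

/-- Interior tangential trace tested with a vector field:
the `i`-th component of the scalar form is tested with the `i`-th component of the field. -/
def interiorTraceVec (F : E3 → E3) (μ : VectorMeasure E3 E3) (U : Set E3) (Φ : E3 → E3) : ℝ :=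
  ∑ i : Fin 3, interiorTrace F μ U (fun x => Φ x i) i

/-- Exterior tangential trace tested with a vector field. -/
def exteriorTraceVec (Ω : Opens E3) (F : E3 → E3) (μ : VectorMeasure E3 E3) (U : Set E3)
    (Φ : E3 → E3) : ℝ :=
  ∑ i : Fin 3, exteriorTrace Ω F μ U (fun x => Φ x i) i

section Functionals

variable {V W : Type} [NormedAddCommGroup V] [NormedSpace ℝ V]
  [NormedAddCommGroup W] [NormedSpace ℝ W]

/-- The functional `L` on `C_c^∞(Ω; V)` is a `W`-valued distribution:
it is linear and continuous for the usual (LF) topology of the space of test functions. -/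
def IsDistribution {Ω : Opens E3} (L : 𝓓(Ω, V) → W) : Prop :=
  ∃ T : 𝓓(Ω, V) →L[ℝ] W, ∀ φ : 𝓓(Ω, V), T φ = L φ

/-- The functional `L` on `C_c^∞(Ω; V)` has order at most `k`: for every compact `K ⊆ Ω` there is
a constant `C` such that `‖L φ‖ ≤ C ‖φ‖_{C^k}` for all test functions supported in `K`. The
`C^k`-norm enters through its upper bounds `M`. -/
def HasOrderAtMost {Ω : Opens E3} (k : ℕ) (L : 𝓓(Ω, V) → W) : Prop :=
  ∀ K : Set E3, IsCompact K → K ⊆ (Ω : Set E3) →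
    ∃ C : ℝ, ∀ φ : 𝓓(Ω, V), tsupport φ ⊆ K →
      ∀ M : ℝ, (∀ j ≤ k, ∀ x : E3, ‖iteratedFDeriv ℝ j φ x‖ ≤ M) → ‖L φ‖ ≤ C * M

/-- The functional `L` on `C_c^∞(Ω; V)` is a distribution of order at most one,
and its distributional support is contained in `S`. -/
def IsOrderOneDistributionSupportedOn {Ω : Opens E3} (S : Set E3) (L : 𝓓(Ω, V) → W) : Prop :=
  IsDistribution L ∧ HasOrderAtMost 1 L ∧ Distribution.dsupport L ⊆ S

end Functionals

end TangentialTrace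

end

namespace TangentialTrace

/-! Up to sign, both traces are the one functional `traceOn` over a set `A`: the interior one has `A
= U`, the exterior one `A = Ω \ closure U`. The measure term is bounded by the sup norm of `φ` times
the total variation. The other term is bounded by that of `∇φ` times the integral of `‖F‖` over a
compact set, finite because `p ≥ 1`. This gives continuity and order at most one.

For the support, `traceOn` vanishes trivially when `φ` lives off `A`
(`traceOn_eq_zero_of_disjoint`). When `φ` lives inside `A`, both integrals extend to `Ω` and cancel
by the definition of the distributional curl (`traceOn_eq_zero_of_subset`).

Vector-valued tests reduce to scalar ones by components, and the integral formulas follow from `∑ᵢ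
(v × ∇Φᵢ)ᵢ = v · curl Φ` (`sum_cross_gradient_apply`). -/

/-- The bilinear pairing `(ℓ, v) ↦ v × ℓ♯`, where `ℓ♯` is the Riesz representative of `ℓ`. -/
noncomputable def crossDual :
    (E3 →L[ℝ] ℝ) →L[ℝ] E3 →L[ℝ] E3 :=
  LinearMap.toContinuousLinearMap
    (LinearMap.toContinuousLinearMap.toLinearMap ∘ₗ
      LinearMap.mk₂ ℝ
        (fun ℓ v => cross v ((InnerProductSpace.toDual ℝ E3).symm ℓ))
        (fun a b v => by ext i; fin_cases i <;> simp [cross] <;> ring)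
        (fun c a v => by ext i; fin_cases i <;> simp [cross] <;> ring)
        (fun a v w => by ext i; fin_cases i <;> simp [cross] <;> ring)
        (fun c a v => by ext i; fin_cases i <;> simp [cross] <;> ring))

theorem crossDual_fderiv (f : E3 → ℝ) (x v : E3) :
    crossDual (fderiv ℝ f x) v = cross v (gradient f x) := rfl

theorem gradient_apply (f : E3 → ℝ) (x : E3) (k : Fin 3) :
    gradient f x k = fderiv ℝ f x (EuclideanSpace.single k 1) := by
  rw [← InnerProductSpace.toDual_symm_apply (𝕜 := ℝ), EuclideanSpace.inner_single_right]
  simp [gradient]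

theorem gradient_eq_zero_of_notMem_tsupport {f : E3 → ℝ} {x : E3} (hx : x ∉ tsupport f) :
    gradient f x = 0 := by
  have : fderiv ℝ f x = 0 :=
    Function.notMem_support.1 fun h => hx (support_fderiv_subset ℝ h)
  simp [gradient, this]

theorem cross_zero_right (v : E3) : cross v 0 = 0 := by
  ext i; fin_cases i <;> simp [cross]

/-- The functional `φ ↦ ∫_A φ d(curl F) - ∫_A F × ∇φ dx`. -/
noncomputable def traceOn (F : E3 → E3) (μ : VectorMeasure E3 E3) (A : Set E3) (φ : E3 → ℝ) : E3 :=
  (∫ᵛ x in A, φ x ∂•μ) - ∫ x in A, cross (F x) (gradient φ x)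

/-! ### The trace functional over a general set. -/

section TraceOn

variable {Ω : Opens E3} {F : E3 → E3} {μ : VectorMeasure E3 E3} {A : Set E3}

theorem integrable_testFunction [IsFiniteMeasure μ.variation] {V : Type} [NormedAddCommGroup V]
    [NormedSpace ℝ V] (φ : 𝓓(Ω, V)) : (μ.restrict A).Integrable φ :=
  φ.continuous.integrable_of_hasCompactSupport φ.hasCompactSupport

theorem locallyIntegrableOn_restrict_of_memLp {p : ℝ≥0∞} (hp : 1 ≤ p)
    (hF : MemLp F p (volume.restrict (Ω : Set E3))) (hA : A ⊆ Ω) :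
    LocallyIntegrableOn F (Ω : Set E3) (volume.restrict A) :=
  ((hF.mono_measure (Measure.restrict_mono hA le_rfl)).locallyIntegrable hp).locallyIntegrableOn _

/-- Integration of test functions against a vector measure of finite variation. -/
noncomputable def integralCLM (Ω : Opens E3) (μ : VectorMeasure E3 E3)
    [IsFiniteMeasure μ.variation] : 𝓓(Ω, ℝ) →L[ℝ] E3 :=
  (LinearMap.mkContinuous
    { toFun := fun f : BoundedContinuousFunction E3 ℝ => ∫ᵛ x, f x ∂•μ
      map_add' := fun f g => VectorMeasure.integral_fun_add (f.integrable _) (g.integrable _)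
      map_smul' := fun c f => VectorMeasure.integral_fun_smul μ _ c f }
    (‖ContinuousLinearMap.lsmul ℝ ℝ (E := E3)‖ * μ.variation.real Set.univ)
    (fun f => (VectorMeasure.norm_integral_le_of_norm_le_const
      (Filter.Eventually.of_forall f.norm_coe_le_norm)).trans_eq (by ring))) ∘L
  TestFunction.toBoundedContinuousFunctionCLM ℝ

theorem isDistribution_traceOn [IsFiniteMeasure μ.variation]
    (hF : LocallyIntegrableOn F (Ω : Set E3) (volume.restrict A)) :
    IsDistribution (fun φ : 𝓓(Ω, ℝ) => traceOn F μ A φ) := by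
  -- `crossDual` takes a functional, not a gradient, so that it pairs directly with `fderiv`.
  refine ⟨integralCLM Ω (μ.restrict A) -
    (TestFunction.integralAgainstBilinCLM crossDual (volume.restrict A) F) ∘L
      TestFunction.fderivCLM ℝ ⊤ ⊤, fun φ => ?_⟩
  have h : ∀ x, TestFunction.fderivCLM ℝ ⊤ ⊤ φ x = fderiv ℝ φ x := fun x => by
    rw [TestFunction.fderivCLM_apply_of_le _ (by simp)]
  rw [sub_apply, ContinuousLinearMap.comp_apply,
    TestFunction.integralAgainstBilinCLM_eq_integral hF]
  simp only [h, crossDual_fderiv]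
  rfl

theorem integrableOn_cross_gradient
    (hF : LocallyIntegrableOn F (Ω : Set E3) (volume.restrict A)) (φ : 𝓓(Ω, ℝ)) :
    Integrable (fun x => cross (F x) (gradient φ x)) (volume.restrict A) := by
  have h := (TestFunction.fderivCLM ℝ ⊤ ⊤ φ).integrable_bilin crossDual hF
  rw [TestFunction.fderivCLM_apply_of_le _ (by simp)] at h
  exact h

theorem hasOrderAtMost_traceOn [IsFiniteMeasure μ.variation]
    (hF : LocallyIntegrableOn F (Ω : Set E3) (volume.restrict A)) :
    HasOrderAtMost 1 (fun φ : 𝓓(Ω, ℝ) => traceOn F μ A φ) := by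
  intro K hK hKΩ
  have hFK : Integrable F ((volume.restrict A).restrict K) :=
    hF.integrableOn_compact_subset hKΩ hK
  refine ⟨‖ContinuousLinearMap.lsmul ℝ ℝ (E := E3)‖ * (μ.restrict A).variation.real Set.univ
    + ‖crossDual‖ * ∫ x in K, ‖F x‖ ∂(volume.restrict A), fun φ hφ M hM => ?_⟩
  have h0 : ∀ x, ‖φ x‖ ≤ M := fun x => by simpa using hM 0 zero_le_one x
  have h1 : ∀ x, ‖fderiv ℝ φ x‖ ≤ M := fun x => by
    simpa only [norm_iteratedFDeriv_one] using hM 1 le_rfl x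
  have hM0 : 0 ≤ M := (norm_nonneg _).trans (h0 0)
  -- `F` is only locally integrable on `Ω`, so the estimate is made on `K`.
  have hK' : ∫ x in A, cross (F x) (gradient φ x)
      = ∫ x in K, cross (F x) (gradient φ x) ∂(volume.restrict A) := by
    refine (setIntegral_eq_integral_of_forall_compl_eq_zero fun x hx => ?_).symm
    rw [gradient_eq_zero_of_notMem_tsupport fun h => hx (hφ h), cross_zero_right]
  have hb : ‖∫ x in A, cross (F x) (gradient φ x)‖
      ≤ ∫ x in K, ‖crossDual‖ * M * ‖F x‖ ∂(volume.restrict A) := by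
    rw [hK']
    refine norm_integral_le_of_norm_le (hFK.norm.const_mul _)
      (Filter.Eventually.of_forall fun x => ?_)
    rw [← crossDual_fderiv]
    exact (crossDual.le_opNorm₂ _ _).trans (by gcongr; exact h1 x)
  rw [integral_const_mul] at hb
  have ha : ‖∫ᵛ x in A, φ x ∂•μ‖ ≤ _ :=
    VectorMeasure.norm_integral_le_of_norm_le_const (Filter.Eventually.of_forall h0)
  calc ‖traceOn F μ A φ‖ ≤ _ := norm_sub_le _ _
    _ ≤ _ := add_le_add ha hb
    _ = _ := by ring

theorem traceOn_eq_zero_of_disjoint {φ : E3 → ℝ} (h : Disjoint A (tsupport φ)) :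
    traceOn F μ A φ = 0 := by
  have hx : ∀ x ∈ A, x ∉ tsupport φ := fun x hx => h.notMem_of_mem_left hx
  rw [traceOn, VectorMeasure.setIntegral_eq_zero_of_forall_eq_zero
    fun x hxA => image_eq_zero_of_notMem_tsupport (hx x hxA),
    setIntegral_eq_zero_of_forall_eq_zero fun x hxA => by
      rw [gradient_eq_zero_of_notMem_tsupport (hx x hxA), cross_zero_right], sub_zero]

/-- Both integrands vanish on `Ω \ A`, so `A` may be replaced by `Ω`, where the equation defining
the curl applies. -/
theorem traceOn_eq_zero_of_subset (hμ : IsCurlMeasure Ω F μ) (hA : MeasurableSet A)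
    (hAΩ : A ⊆ Ω) (φ : 𝓓(Ω, ℝ)) (h : (Ω : Set E3) ∩ tsupport φ ⊆ A) :
    traceOn F μ A φ = 0 := by
  have hx : ∀ x ∈ (Ω : Set E3) \ A, x ∉ tsupport φ := fun x hx hxφ => hx.2 (h ⟨hx.1, hxφ⟩)
  rw [traceOn, ← VectorMeasure.setIntegral_eq_of_subset_of_forall_sdiff_eq_zero hA
      Ω.isOpen.measurableSet hAΩ fun x hxA => image_eq_zero_of_notMem_tsupport (hx x hxA),
    ← setIntegral_eq_of_subset_of_forall_sdiff_eq_zero Ω.isOpen.measurableSet hAΩ fun x hxA => by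
      rw [gradient_eq_zero_of_notMem_tsupport (hx x hxA), cross_zero_right],
    hμ.integral_eq φ, sub_self]

theorem sum_setIntegral_apply_eq [IsFiniteMeasure μ.variation] (Φ : 𝓓(Ω, E3)) :
    ∑ i : Fin 3, (∫ᵛ x in A, Φ x i ∂•μ) i = ∫ᵛ x in A, Φ x ∂[innerSL ℝ; μ] := by
  -- The pairing on the right is `(v, w) ↦ vᵢ wᵢ`; summed over `i`, these give the inner product.
  have h : ∀ i : Fin 3, (∫ᵛ x in A, Φ x i ∂•μ) i =
      ∫ᵛ x in A, Φ x ∂[(ContinuousLinearMap.compL ℝ E3 E3 ℝ (EuclideanSpace.proj i) ∘L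
        ContinuousLinearMap.lsmul ℝ ℝ) ∘L EuclideanSpace.proj i; μ] := fun i => by
    have hΦ : (μ.restrict A).Integrable Φ := integrable_testFunction Φ
    rw [← VectorMeasure.integral_continuousLinearMap_comp hΦ,
      ← VectorMeasure.continuousLinearMap_apply_integral
        ((EuclideanSpace.proj i : E3 →L[ℝ] ℝ).integrable_comp hΦ)]
    rfl
  simp only [h]
  rw [← VectorMeasure.integral_finsetSum_cbm (integrable_testFunction Φ)]
  congr 1
  ext v w
  rw [innerSL_apply_apply, PiLp.inner_apply]
  simp [Fin.sum_univ_three, mul_comm]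

theorem sum_cross_gradient_apply (Φ : E3 → E3) (v x : E3) :
    ∑ i : Fin 3, cross v (gradient (fun y => Φ y i) x) i = inner ℝ v (curl Φ x) := by
  simp only [Fin.sum_univ_three, cross, curl, partialDeriv, gradient_apply, PiLp.inner_apply]
  simp
  ring

/-- The `i`-th component of a vector-valued test function. -/
noncomputable def component (i : Fin 3) : 𝓓(Ω, E3) →L[ℝ] 𝓓(Ω, ℝ) :=
  TestFunction.postcompCLM (EuclideanSpace.proj i)

theorem coe_component (i : Fin 3) (Φ : 𝓓(Ω, E3)) : ⇑(component i Φ) = fun x => Φ x i := rfl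

theorem sum_traceOn_component_apply [IsFiniteMeasure μ.variation]
    (hF : LocallyIntegrableOn F (Ω : Set E3) (volume.restrict A)) (Φ : 𝓓(Ω, E3)) :
    ∑ i : Fin 3, traceOn F μ A (component i Φ) i =
      (∫ᵛ x in A, Φ x ∂[innerSL ℝ; μ]) - ∫ x in A, inner ℝ (F x) (curl Φ x) := by
  have h : ∀ i : Fin 3, Integrable (fun x => cross (F x) (gradient (component i Φ) x))
      (volume.restrict A) := fun i => integrableOn_cross_gradient hF _
  have h' : ∀ i : Fin 3, (∫ x in A, cross (F x) (gradient (component i Φ) x)) i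
      = ∫ x in A, cross (F x) (gradient (component i Φ) x) i := fun i =>
    ((EuclideanSpace.proj i : E3 →L[ℝ] ℝ).integral_comp_comm (h i)).symm
  simp only [traceOn, PiLp.sub_apply, Finset.sum_sub_distrib, h']
  have h'' : ∀ i : Fin 3, Integrable (fun x => cross (F x) (gradient (component i Φ) x) i)
      (volume.restrict A) := fun i =>
    (EuclideanSpace.proj i : E3 →L[ℝ] ℝ).integrable_comp (h i)
  rw [← integral_finsetSum _ fun i _ => h'' i]
  simp only [coe_component, sum_cross_gradient_apply, sum_setIntegral_apply_eq]

end TraceOn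

/-! ### Supports, and passage from scalar to vector-valued tests. -/

section Functionals

variable {Ω : Opens E3} {S : Set E3} {L : 𝓓(Ω, ℝ) → E3}

theorem IsDistribution.neg (h : IsDistribution L) : IsDistribution fun φ => -L φ :=
  let ⟨T, hT⟩ := h
  ⟨-T, fun φ => by simp [hT]⟩

theorem HasOrderAtMost.neg {k : ℕ} (h : HasOrderAtMost k L) :
    HasOrderAtMost k fun φ => -L φ := fun K hK hKΩ =>
  let ⟨C, hC⟩ := h K hK hKΩ
  ⟨C, fun φ hφ M hM => by simpa using hC φ hφ M hM⟩

/-- A point off the frontier lies in `U` or in the complement of its closure, both open. -/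
theorem dsupport_subset_frontier {V W : Type} [NormedAddCommGroup V] [NormedSpace ℝ V]
    [NormedAddCommGroup W] {L : 𝓓(Ω, V) → W} {U : Set E3} (hU : IsOpen U)
    (h₁ : Distribution.IsVanishingOn L U) (h₂ : Distribution.IsVanishingOn L (closure U)ᶜ) :
    Distribution.dsupport L ⊆ frontier U := by
  intro x hx
  by_contra hxU
  have hx' := (Distribution.mem_dsupport_iff_not_isVanishingOn x).1 hx
  by_cases h : x ∈ U
  · exact hx' U h hU h₁
  · exact hx' (closure U)ᶜ (fun hc => hxU ⟨hc, by rwa [hU.interior_eq]⟩) isClosed_closure.isOpen_compl h₂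

theorem tsupport_component_subset (i : Fin 3) (Φ : 𝓓(Ω, E3)) :
    tsupport (component i Φ) ⊆ tsupport Φ :=
  tsupport_comp_subset (g := (EuclideanSpace.proj i : E3 →L[ℝ] ℝ)) (map_zero _) Φ

/-- Testing the components of a vector-valued distribution with the components of vector fields
preserves being a distribution of order at most one supported on a given set. -/
theorem IsOrderOneDistributionSupportedOn.sum_component
    (h : IsOrderOneDistributionSupportedOn S L) :
    IsOrderOneDistributionSupportedOn S
      (fun Φ : 𝓓(Ω, E3) => ∑ i : Fin 3, L (component i Φ) i) := by
  obtain ⟨⟨T, hT⟩, hord, hsupp⟩ := h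
  refine ⟨⟨∑ i : Fin 3, EuclideanSpace.proj i ∘L T ∘L component i, fun Φ => ?_⟩, ?_, ?_⟩
  · simp [hT]
  · intro K hK hKΩ
    obtain ⟨C, hC⟩ := hord K hK hKΩ
    -- There are three components, and each coordinate projection has norm at most one, so `M` also
    -- bounds the derivatives of every component.
    refine ⟨3 * C, fun Φ hΦ M hM => ?_⟩
    have hi : ∀ i : Fin 3, ‖L (component i Φ) i‖ ≤ C * M := fun i => by
      refine (PiLp.norm_apply_le _ i).trans
        (hC _ ((tsupport_component_subset i Φ).trans hΦ) M fun j hj x => ?_)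
      refine (ContinuousLinearMap.norm_iteratedFDeriv_comp_left
        (EuclideanSpace.proj i : E3 →L[ℝ] ℝ) Φ.contDiff.contDiffAt (n := j)
        (by exact_mod_cast le_top)).trans ?_
      refine (mul_le_of_le_one_left (norm_nonneg _) ?_).trans (hM j hj x)
      exact ContinuousLinearMap.opNorm_le_bound _ zero_le_one fun v => by
        simpa using PiLp.norm_apply_le v i
    calc ‖∑ i : Fin 3, L (component i Φ) i‖ ≤ ∑ i : Fin 3, ‖L (component i Φ) i‖ :=
          norm_sum_le _ _
      _ ≤ ∑ _i : Fin 3, C * M := Finset.sum_le_sum fun i _ => hi i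
      _ = 3 * C * M := by simp; ring
  · refine Set.Subset.trans (fun x hx => ?_) hsupp
    by_contra hxL
    obtain ⟨s, hs, hso, hxs⟩ := (Distribution.notMem_dsupport_iff x).1 hxL
    refine (Distribution.mem_dsupport_iff_not_isVanishingOn x).1 hx s hxs hso fun Φ hΦ => ?_
    exact Finset.sum_eq_zero fun i _ => by
      rw [hs _ ((tsupport_component_subset i Φ).trans hΦ), PiLp.zero_apply]

end Functionals

/-! ### The interior and exterior traces. -/

section Traces

variable {Ω : Opens E3} {F : E3 → E3} {μ : VectorMeasure E3 E3} {U : Set E3}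

theorem exteriorTrace_eq_neg_traceOn (φ : E3 → ℝ) :
    exteriorTrace Ω F μ U φ = -traceOn F μ ((Ω : Set E3) \ closure U) φ := by
  rw [exteriorTrace, traceOn, neg_sub', sub_neg_eq_add]

theorem isOrderOneDistributionSupportedOn_interiorTrace [IsFiniteMeasure μ.variation]
    (hF : LocallyIntegrableOn F (Ω : Set E3) (volume.restrict U)) (hμ : IsCurlMeasure Ω F μ)
    (hU : IsOpen U) (hUΩ : U ⊆ Ω) :
    IsOrderOneDistributionSupportedOn (frontier U)
      (fun φ : 𝓓(Ω, ℝ) => interiorTrace F μ U φ) := by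
  refine ⟨isDistribution_traceOn hF, hasOrderAtMost_traceOn hF,
    dsupport_subset_frontier hU (fun φ hφ => ?_) fun φ hφ => ?_⟩
  · exact traceOn_eq_zero_of_subset hμ hU.measurableSet hUΩ φ (Set.inter_subset_right.trans hφ)
  · exact traceOn_eq_zero_of_disjoint
      (Set.disjoint_left.2 fun x hxU hx => hφ hx (subset_closure hxU))

/-- Compared with the interior trace, the two vanishing arguments swap roles: tests supported in `U`
miss the domain of integration, the others use the curl equation. -/
theorem isOrderOneDistributionSupportedOn_exteriorTrace [IsFiniteMeasure μ.variation]
    (hF : LocallyIntegrableOn F (Ω : Set E3) (volume.restrict ((Ω : Set E3) \ closure U)))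
    (hμ : IsCurlMeasure Ω F μ) (hU : IsOpen U) :
    IsOrderOneDistributionSupportedOn (frontier U)
      (fun φ : 𝓓(Ω, ℝ) => exteriorTrace Ω F μ U φ) := by
  simp only [exteriorTrace_eq_neg_traceOn]
  refine ⟨(isDistribution_traceOn hF).neg, (hasOrderAtMost_traceOn hF).neg,
    dsupport_subset_frontier hU (fun φ hφ => ?_) fun φ hφ => ?_⟩
  · exact neg_eq_zero.2 (traceOn_eq_zero_of_disjoint
      (Set.disjoint_left.2 fun x hxU hx => hxU.2 (subset_closure (hφ hx))))
  · exact neg_eq_zero.2 (traceOn_eq_zero_of_subset hμ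
      (Ω.isOpen.measurableSet.diff isClosed_closure.measurableSet) Set.sdiff_subset φ
      fun x hx => ⟨hx.1, hφ hx.2⟩)

end Traces

end TangentialTrace

theorem mainTheorem8 (Ω : Opens TangentialTrace.E3) (p : ℝ≥0∞) (hp : 1 ≤ p)
    (F : TangentialTrace.E3 → TangentialTrace.E3)
    (hF : TangentialTrace.IsCurlMeasureField p Ω F)
    (μ : VectorMeasure TangentialTrace.E3 TangentialTrace.E3)
    (hμ : TangentialTrace.IsCurlMeasure Ω F μ)
    (U : Set TangentialTrace.E3) (hU : IsOpen U) (hUc : IsCompact (closure U))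
    (hUΩ : closure U ⊆ (Ω : Set TangentialTrace.E3)) :
    -- scalar test functions
    TangentialTrace.IsOrderOneDistributionSupportedOn (frontier U)
      (fun φ : 𝓓(Ω, ℝ) => TangentialTrace.interiorTrace F μ U φ) ∧
    TangentialTrace.IsOrderOneDistributionSupportedOn (frontier U)
      (fun φ : 𝓓(Ω, ℝ) => TangentialTrace.exteriorTrace Ω F μ U φ) ∧
    -- vector-valued test functions
    TangentialTrace.IsOrderOneDistributionSupportedOn (frontier U)
      (fun Φ : 𝓓(Ω, TangentialTrace.E3) => TangentialTrace.interiorTraceVec F μ U Φ) ∧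
    TangentialTrace.IsOrderOneDistributionSupportedOn (frontier U)
      (fun Φ : 𝓓(Ω, TangentialTrace.E3) => TangentialTrace.exteriorTraceVec Ω F μ U Φ) ∧
    -- the integral form of the vector-tested traces
    (∀ Φ : 𝓓(Ω, TangentialTrace.E3),
      TangentialTrace.interiorTraceVec F μ U Φ =
        (∫ᵛ x in U, Φ x ∂[innerSL ℝ; μ])
          - ∫ x in U, inner ℝ (F x) (TangentialTrace.curl Φ x)) ∧
    (∀ Φ : 𝓓(Ω, TangentialTrace.E3),
      TangentialTrace.exteriorTraceVec Ω F μ U Φ =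
        -(∫ᵛ x in ((Ω : Set TangentialTrace.E3) \ closure U), Φ x ∂[innerSL ℝ; μ])
          + ∫ x in (Ω : Set TangentialTrace.E3) \ closure U,
              inner ℝ (F x) (TangentialTrace.curl Φ x)) := by
  have : IsFiniteMeasure μ.variation := ⟨hμ.finite_variation⟩
  have hUΩ' : U ⊆ Ω := subset_closure.trans hUΩ
  have hint := TangentialTrace.locallyIntegrableOn_restrict_of_memLp hp hF.1 hUΩ'
  have hext := TangentialTrace.locallyIntegrableOn_restrict_of_memLp hp hF.1
    (Set.sdiff_subset (s := (Ω : Set TangentialTrace.E3)) (t := closure U))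
  have h₁ := TangentialTrace.isOrderOneDistributionSupportedOn_interiorTrace hint hμ hU hUΩ'
  have h₂ := TangentialTrace.isOrderOneDistributionSupportedOn_exteriorTrace hext hμ hU
  -- The interior formula needs no rewriting, since `interiorTrace` unfolds to `traceOn` over `U`;
  -- the exterior one needs the sign change.
  refine ⟨h₁, h₂, h₁.sum_component, h₂.sum_component,
    TangentialTrace.sum_traceOn_component_apply hint, fun Φ => ?_⟩
  have h := TangentialTrace.sum_traceOn_component_apply (μ := μ) hext Φ
  simp only [TangentialTrace.exteriorTraceVec, TangentialTrace.exteriorTrace_eq_neg_traceOn,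
    PiLp.neg_apply, Finset.sum_neg_distrib]
  simp only [TangentialTrace.coe_component] at h
  rw [h, neg_sub', sub_neg_eq_add]
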